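/- Let $\beta>1$ be a quadratic Pisot unit with positive conjugate, that is, an algebraic unit of degree $2$ over $\mathbb{Q}$ whose other conjugate $\beta'$ satisfies $0<\beta'<1$ (equivalently, $\beta>1$ satisfies $\beta^2=m\beta-1$ for some integer $m\ge 3$). Let $I_\beta=\left[-\frac{\beta}{\beta+1},\frac{1}{\beta+1}\right)$, let $T_{-\beta}:I_\beta\to I_\beta$, $T_{-\beta}(x)=-\beta x-\left\lfloor-\beta x+\frac{\beta}{\beta+1}\right\rfloor$, and for $x\in I_\beta$ let the $(-\beta)$-expansion of $x$ be the digit sequence $d_{-\beta}(x)=x_1x_2x_3\cdots$ with $x_i=\left\lfloor-\beta\, T_{-\beta}^{\,i-1}(x)+\frac{\beta}{\beta+1}\right\rfloor$. Then every rational $x\in I_\beta$ has a purely periodic $(-\beta)$-expansion, i.e. there is $N\ge 1$ such that $x_{i+N}=x_i$ for all $i\ge 1$. -/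

import Mathlib

/-- A Pisot number: a real algebraic integer `β > 1` all of whose other conjugates
(complex roots of its minimal polynomial) have modulus less than `1`. -/
def IsPisot (β : ℝ) : Prop :=
  1 < β ∧ IsIntegral ℤ β ∧
    ∀ z : ℂ, Polynomial.aeval z (minpoly ℚ β) = 0 → z ≠ (β : ℂ) → ‖z‖ < 1

/-- An algebraic unit: an algebraic integer whose inverse is again an algebraic integer. -/
def IsAlgebraicUnit (β : ℝ) : Prop :=
  IsIntegral ℤ β ∧ ∃ γ : ℝ, IsIntegral ℤ γ ∧ β * γ = 1

/-- A quadratic number: algebraic of degree `2` over `ℚ`. -/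
def IsQuadratic (β : ℝ) : Prop :=
  IsIntegral ℚ β ∧ (minpoly ℚ β).natDegree = 2

/-- `β'` is an algebraic conjugate of `β` different from `β`. -/
def IsOtherConjugate (β β' : ℝ) : Prop :=
  β' ≠ β ∧ Polynomial.aeval β' (minpoly ℚ β) = 0

/-- The interval `I_β = [-β/(β+1), 1/(β+1))`. -/
def negInterval (β : ℝ) : Set ℝ :=
  Set.Ico (-(β / (β + 1))) (1 / (β + 1))

/-- The transformation `T_{-β}(x) = -βx - ⌊-βx + β/(β+1)⌋`. -/
noncomputable def negTransform (β x : ℝ) : ℝ :=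
  -β * x - (⌊-β * x + β / (β + 1)⌋ : ℝ)

/-- The transformation sends every real number, in particular every point of `I_β`, into `I_β`. -/
theorem negTransform_mem {β : ℝ} (hβ : 1 < β) (x : ℝ) :
    negTransform β x ∈ negInterval β := by
  have h1 := Int.floor_le (-β * x + β / (β + 1))
  have h2 := Int.lt_floor_add_one (-β * x + β / (β + 1))
  have h3 : β / (β + 1) + 1 / (β + 1) = 1 := by
    have : β + 1 ≠ 0 := by linarith
    field_simp
  unfold negTransform negInterval
  constructor <;> linarith

/-- The digit sequence `d_{-β}(x)` of the `(-β)`-expansion of `x`; the digit with index `i` here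
is `⌊-β T_{-β}^i(x) + β/(β+1)⌋`, so the first digit has index `0`. -/
noncomputable def negExpansion (β x : ℝ) : ℕ → ℤ :=
  fun i => ⌊-β * (negTransform β)^[i] x + β / (β + 1)⌋

/-- `x` has a purely periodic `(-β)`-expansion: `d_{-β}(x)` is the infinite repetition of a
nonempty finite block of digits. -/
def HasPurelyPeriodicNegExpansion (β x : ℝ) : Prop :=
  ∃ N : ℕ, 0 < N ∧ ∀ i : ℕ, negExpansion β x (i + N) = negExpansion β x i

/-!
The hypotheses say that `β` and `β'` are the roots of `X² - mX + 1` for an integer `m ≥ 3`, so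
`β' = β⁻¹`. Put `r = 1/(β+1)`, so that `I_β = [-βr, r)`, and let the transformation act on pairs
`(u, v)` by

  `(u, v) ↦ (-βu - d, -β'v - d)`, where `d` is the first digit of `u`.

This is a natural extension of `T_{-β}`. Over `[-βr, -β'r]` take the open fibre `(a - β, a)`, and
over `(-β'r, r)` the open fibre `(a - β + 1, a)`, where `a = (1 - β')/(1 + β')`. The left endpoint
has the periodic orbit `-βr ↦ -β'r ↦ -βr`, and `u > -β'r` exactly when the digit of `u` is `0`; with
this the resulting domain is mapped into itself (`NegDomain.step`). Because the larger fibre has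
length `β = 1/β'`, the images of the fibres under `v ↦ -β'v - d` for different digits `d` are
disjoint, so the second coordinate of the image determines the digit (`NegDomain.digit_le`) and the
map is injective. Open fibres make this hold with no exceptional boundary points.

For a rational `x` with denominator `q`, the orbit of `(x, x)` stays among the pairs
`((s + tβ)/q, (s + tβ')/q)` with `s, t` integers. Only finitely many of them lie in the bounded
domain (`finite_setOf_negDomain`), and the map permutes these. Since `(x, x)` lies in the domain
(`NegDomain.diagonal`), it is a periodic point, and so its digits are purely periodic.
-/

/-! ### The minimal equation of a quadratic Pisot unit -/

open Polynomial in
/-- If an integral polynomial vanishes at `β`, it vanishes at every conjugate; applied to the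
reverse of an integral equation of `β⁻¹`, this makes the inverse of every conjugate integral. -/
theorem isIntegral_inv_of_conjugate {β β' : ℝ} (h0 : β ≠ 0) (h0' : β' ≠ 0)
    (hβ : IsIntegral ℤ β⁻¹) (hroot : aeval β' (minpoly ℚ β) = 0) : IsIntegral ℤ β'⁻¹ := by
  obtain ⟨p, hp, hpz⟩ := hβ
  have key : ∀ y : ℝ, y ≠ 0 → (eval₂ (algebraMap ℤ ℝ) y⁻¹ p = 0 ↔
      aeval y (p.reverse.map (algebraMap ℤ ℚ)) = 0) := by
    intro y hy
    let := invertibleOfNonzero (inv_ne_zero hy)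
    have hu : ⅟ y⁻¹ = y := by rw [invOf_eq_inv, inv_inv]
    have h := eval₂_reverse_eq_zero_iff (algebraMap ℤ ℝ) y⁻¹ p
    rw [hu] at h
    rw [aeval_map_algebraMap, aeval_def, h]
  refine ⟨p, hp, (key β' h0').2 ?_⟩
  obtain ⟨g, hg⟩ := minpoly.dvd ℚ β ((key β h0).1 hpz)
  rw [hg, map_mul, hroot, zero_mul]

open Polynomial in
/-- A quadratic Pisot unit with positive conjugate `β'` is a root of `X² - mX + 1`. -/
theorem exists_trace_of_quadratic_pisot_unit {β β' : ℝ} (hPisot : IsPisot β)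
    (hUnit : IsAlgebraicUnit β) (hQuad : IsQuadratic β) (hConj : IsOtherConjugate β β')
    (hPos : 0 < β') : β' < 1 ∧ β * β' = 1 ∧ ∃ m : ℤ, β + β' = m := by
  obtain ⟨h1, hint, hpis⟩ := hPisot
  obtain ⟨hne, hroot⟩ := hConj
  obtain ⟨_, γ, hγ, hγ1⟩ := hUnit
  have h0 : β ≠ 0 := by linarith
  have hlt : β' < 1 := by
    have h := hpis (β' : ℂ) (by
      have := Polynomial.aeval_algebraMap_apply ℂ β' (minpoly ℚ β)
      rw [hroot, map_zero] at this
      exact this) (by exact_mod_cast hne)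
    rwa [Complex.norm_real, Real.norm_of_nonneg hPos.le] at h
  have hmin : minpoly ℚ β = (minpoly ℤ β).map (algebraMap ℤ ℚ) :=
    minpoly.isIntegrallyClosed_eq_field_fractions' ℚ hint
  have hmonic : (minpoly ℤ β).Monic := minpoly.monic hint
  have hdeg : (minpoly ℤ β).natDegree = 2 := by
    rw [← hQuad.2, hmin, hmonic.natDegree_map]
  have hroot' : aeval β' (minpoly ℤ β) = 0 := by
    rwa [hmin, aeval_map_algebraMap] at hroot
  have hlead : (minpoly ℤ β).coeff 2 = 1 := by
    have := hmonic.coeff_natDegree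
    rwa [hdeg] at this
  have heval : ∀ y : ℝ, aeval y (minpoly ℤ β) = 0 →
      (minpoly ℤ β).coeff 0 + (minpoly ℤ β).coeff 1 * y + y ^ 2 = 0 := by
    intro y hy
    rw [aeval_eq_sum_range, hdeg] at hy
    simpa [Finset.sum_range_succ, hlead] using hy
  have e1 := heval β (minpoly.aeval ℤ β)
  have e2 := heval β' hroot'
  have hsum : β + β' = ((-(minpoly ℤ β).coeff 1 : ℤ) : ℝ) := by
    have : (β' - β) * (β + β' + (minpoly ℤ β).coeff 1) = 0 := by linear_combination e2 - e1
    rcases mul_eq_zero.1 this with h | h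
    · exact absurd (sub_eq_zero.1 h) hne
    · push_cast; linarith
  have hprod : β * β' = (((minpoly ℤ β).coeff 0 : ℤ) : ℝ) := by
    push_cast at hsum
    linear_combination β * hsum - e1
  have hγβ : γ = β⁻¹ := eq_inv_of_mul_eq_one_right hγ1
  have hinv : IsIntegral ℤ ((β * β')⁻¹) := by
    rw [mul_inv]
    exact (hγβ ▸ hγ).mul (isIntegral_inv_of_conjugate h0 hPos.ne' (hγβ ▸ hγ) hroot)
  refine ⟨hlt, ?_, _, hsum⟩
  generalize (minpoly ℤ β).coeff 0 = n at hprod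
  have hn0 : 0 < n := by
    have : 0 < β * β' := by positivity
    rw [hprod] at this
    exact_mod_cast this
  have hq : IsIntegral ℤ ((n : ℚ)⁻¹) := by
    rw [← isIntegral_algebraMap_iff (algebraMap ℚ ℝ).injective]
    simpa [hprod] using hinv
  obtain ⟨k, hk⟩ := IsIntegrallyClosed.isIntegral_iff.1 hq
  have hnk : n * k = 1 := by
    have : (n : ℚ) * k = 1 := by
      have hk' : (k : ℚ) = (n : ℚ)⁻¹ := by simpa using hk
      rw [hk', mul_inv_cancel₀ (by exact_mod_cast hn0.ne')]
    exact_mod_cast this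
  have hn1 : n = 1 := Int.eq_one_of_mul_eq_one_right hn0.le hnk
  rw [hprod, hn1, Int.cast_one]

/-! ### The natural extension -/

/-- The first digit of the `(-β)`-expansion of `u`. -/
noncomputable def negDigit (β u : ℝ) : ℤ := ⌊-β * u + β / (β + 1)⌋

/-- The upper end `(1 - β')/(1 + β')` of the fibres of the natural extension domain. -/
noncomputable def fibreTop (β' : ℝ) : ℝ := (1 - β') / (1 + β')

/-- The domain of the natural extension of `T_{-β}`, where `β' = β⁻¹`: the points `(u, v)` with
`u ∈ I_β` and `v` in an open fibre of length `β`, which is shortened by `1` from below over the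
cylinder of the digit `0`. -/
structure NegDomain (β β' u v : ℝ) : Prop where
  mem : u ∈ negInterval β
  lt_top : v < fibreTop β'
  bot_lt : fibreTop β' - β < v
  bot_lt' : negDigit β u = 0 → fibreTop β' - β + 1 < v

theorem negDigit_nonneg {β u : ℝ} (h1 : 1 < β) (hu : u ∈ negInterval β) : 0 ≤ negDigit β u := by
  refine Int.floor_nonneg.2 ?_
  have hu2 := mul_le_mul_of_nonneg_left hu.2.le (by linarith : (0 : ℝ) ≤ β)
  have : β * (1 / (β + 1)) = β / (β + 1) := by ring
  linarith

theorem negDigit_le {β u : ℝ} (h1 : 1 < β) (hu : u ∈ negInterval β) : (negDigit β u : ℝ) ≤ β := by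
  have hfl := Int.floor_le (-β * u + β / (β + 1))
  have hu1 := mul_le_mul_of_nonneg_left hu.1 (by linarith : (0 : ℝ) ≤ β)
  have : β * (β / (β + 1)) + β / (β + 1) = β := by
    have : β + 1 ≠ 0 := by linarith
    field_simp
  unfold negDigit
  linarith

theorem negTransform_eq (β u : ℝ) : negTransform β u = -β * u - negDigit β u := rfl

/-- The largest digit `m - 1` leads into `[-β/(β+1), -β'/(β+1)]`, where the digit `0` does not
occur. -/
theorem negDigit_negTransform_ne_zero {β β' u : ℝ} {m : ℤ} (h1 : 1 < β) (hprod : β * β' = 1)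
    (hsum : β + β' = m) (hu : u ∈ negInterval β) (hd : negDigit β u = m - 1) :
    negDigit β (negTransform β u) ≠ 0 := by
  intro h0
  have hlt := Int.lt_floor_add_one (-β * negTransform β u + β / (β + 1))
  change _ < (negDigit β (negTransform β u) : ℝ) + 1 at hlt
  rw [h0, negTransform_eq, hd] at hlt
  push_cast at hlt
  rw [← hsum] at hlt
  have hu1 := mul_le_mul_of_nonneg_left hu.1 (by positivity : (0 : ℝ) ≤ β * β)
  have : β * β * (β / (β + 1)) = β * β - β + β / (β + 1) := by
    have : β + 1 ≠ 0 := by linarith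
    field_simp
    ring
  nlinarith

/-- The identity that glues the fibres: the lower end of the smaller fibre is sent to the common
upper end by `v ↦ -β'v`. -/
theorem fibreTop_glue {β β' : ℝ} (hPos : 0 < β') (hprod : β * β' = 1) :
    fibreTop β' = -β' * (fibreTop β' - β + 1) := by
  have h : fibreTop β' * (1 + β') = 1 - β' := div_mul_cancel₀ _ (by linarith)
  linear_combination h - hprod

/-- The natural extension maps its domain into itself. -/
theorem NegDomain.step {β β' u v : ℝ} {m : ℤ} (h1 : 1 < β) (hPos : 0 < β') (hlt : β' < 1)
    (hprod : β * β' = 1) (hsum : β + β' = m) (h : NegDomain β β' u v) :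
    NegDomain β β' (negTransform β u) (-β' * v - negDigit β u) := by
  have hd0 := negDigit_nonneg h1 h.mem
  have hdm : negDigit β u ≤ m - 1 := by
    have hd := negDigit_le h1 h.mem
    have : (negDigit β u : ℝ) < m := by linarith
    have : negDigit β u < m := by exact_mod_cast this
    omega
  have hglue := fibreTop_glue hPos hprod
  have hbot := h.bot_lt'
  have htop := mul_lt_mul_of_pos_left h.lt_top hPos
  have hlow := mul_lt_mul_of_pos_left h.bot_lt hPos
  refine ⟨negTransform_mem h1 u, ?_, ?_, ?_⟩
  · rcases hd0.eq_or_lt with hd | hd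
    · have := mul_lt_mul_of_pos_left (hbot hd.symm) hPos
      rw [← hd, Int.cast_zero]
      linarith
    · have : (1 : ℝ) ≤ negDigit β u := by exact_mod_cast hd
      linarith
  · have : (negDigit β u : ℝ) ≤ m - 1 := by exact_mod_cast hdm
    linarith
  · intro h0
    have hne : negDigit β u ≠ m - 1 := fun hd =>
      negDigit_negTransform_ne_zero h1 hprod hsum h.mem hd h0
    have : (negDigit β u : ℝ) ≤ m - 2 := by
      have : negDigit β u ≤ m - 2 := by omega
      exact_mod_cast this
    linarith

/-- Fibres shifted by different digits have disjoint images, because a fibre has length at most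
`β` and is contracted by `β' = β⁻¹`. Hence the digit can be read off from the image. -/
theorem NegDomain.digit_le {β β' u v u₁ v₁ : ℝ} (hPos : 0 < β') (hprod : β * β' = 1)
    (h : NegDomain β β' u v) (h₁ : NegDomain β β' u₁ v₁)
    (heq : -β' * v - negDigit β u = -β' * v₁ - negDigit β u₁) :
    negDigit β u ≤ negDigit β u₁ := by
  have hlow := mul_lt_mul_of_pos_left h.bot_lt hPos
  have htop := mul_lt_mul_of_pos_left h₁.lt_top hPos
  have : (negDigit β u : ℝ) < negDigit β u₁ + 1 := by linarith
  have : negDigit β u < negDigit β u₁ + 1 := by exact_mod_cast this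
  omega

/-- The diagonal points over `I_β` lie in the domain. The bound `2 < β` keeps the right end
`β'/(1 + β')` of `I_β` below the upper end `(1 - β')/(1 + β')` of the fibres. -/
theorem NegDomain.diagonal {β β' x : ℝ} (h2 : 2 < β) (hPos : 0 < β') (hprod : β * β' = 1)
    (hx : x ∈ negInterval β) : NegDomain β β' x x := by
  have hhalf : 2 * β' < 1 := by nlinarith
  have hr : 1 / (β + 1) = β' / (1 + β') := by
    rw [div_eq_div_iff (by linarith) (by linarith)]
    linarith
  have hl : β / (β + 1) = 1 - 1 / (β + 1) := by
    have : β + 1 ≠ 0 := by linarith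
    field_simp
    ring
  have hr0 : 0 < 1 / (β + 1) := by positivity
  have htop : 1 / (β + 1) < fibreTop β' := by
    rw [hr]
    exact div_lt_div_of_pos_right (by linarith) (by linarith)
  have htop1 : fibreTop β' < 1 := (div_lt_one (by linarith)).2 (by linarith)
  have hx1 := hx.1
  refine ⟨hx, hx.2.trans htop, by linarith, fun h0 => ?_⟩
  have hfl := Int.lt_floor_add_one (-β * x + β / (β + 1))
  change _ < (negDigit β x : ℝ) + 1 at hfl
  rw [h0, Int.cast_zero, zero_add] at hfl
  have hglue := fibreTop_glue hPos hprod
  have htop' : fibreTop β' - β + 1 = -β * fibreTop β' := by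
    linear_combination β * hglue - (fibreTop β' - β + 1) * hprod
  -- The digit `0` gives `-βx < 1/(β+1)`, and the fibre starts at `-β a` with `1/(β+1) < a`.
  have hβx : -β * x < 1 / (β + 1) := by linarith
  rw [htop']
  nlinarith

/-! ### Lattice points and periodicity -/

/-- The real number `(s + tβ)/q` with coordinates `(s, t)`. -/
noncomputable def latticeVal (q : ℤ) (β : ℝ) (p : ℤ × ℤ) : ℝ := (p.1 + p.2 * β) / q

/-- The map `T_{-β}` in the coordinates of `latticeVal`, using `β² = mβ - 1`. -/
noncomputable def latticeStep (q m : ℤ) (β : ℝ) (p : ℤ × ℤ) : ℤ × ℤ :=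
  (p.2 - negDigit β (latticeVal q β p) * q, -p.1 - m * p.2)

/-- Both conjugates `α ∈ {β, β'}` are covered: each is a root of `X² - mX + 1`, while the digit is
always that of the first coordinate. -/
theorem latticeVal_latticeStep {q m : ℤ} {α : ℝ} (β : ℝ) (hq : q ≠ 0) (hα : α ^ 2 = m * α - 1)
    (p : ℤ × ℤ) : latticeVal q α (latticeStep q m β p) =
      -α * latticeVal q α p - negDigit β (latticeVal q β p) := by
  have hq' : (q : ℝ) ≠ 0 := by exact_mod_cast hq
  simp only [latticeVal, latticeStep]
  push_cast
  field_simp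
  linear_combination (p.2 : ℝ) * hα

/-- Only finitely many lattice points lie in the bounded domain: `s` and `t` are linear
combinations of the two conjugate values. -/
theorem finite_setOf_negDomain {q : ℤ} {β β' : ℝ} (hq : 0 < q) (hPos : 0 < β') (h1 : 1 < β)
    (hlt : β' < 1) :
    {p : ℤ × ℤ | NegDomain β β' (latticeVal q β p) (latticeVal q β' p)}.Finite := by
  have hq' : (0 : ℝ) < q := by exact_mod_cast hq
  have htop : fibreTop β' < 1 := (div_lt_one (by linarith)).2 (by linarith)
  have htop0 : 0 < fibreTop β' := div_pos (by linarith) (by linarith)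
  have hr : 1 / (β + 1) < 1 := (div_lt_one (by linarith)).2 (by linarith)
  have hl : β / (β + 1) < 1 := (div_lt_one (by linarith)).2 (by linarith)
  obtain ⟨K, hK⟩ := exists_nat_gt (q * (β + 1) / (β - β'))
  obtain ⟨L, hL⟩ := exists_nat_gt (q + K * β)
  refine ((Set.finite_Icc (-(L : ℤ)) L).prod (Set.finite_Icc (-(K : ℤ)) K)).subset ?_
  rintro ⟨s, t⟩ ⟨⟨hu1, hu2⟩, hv2, hv1, -⟩
  set u := latticeVal q β (s, t) with hu
  set v := latticeVal q β' (s, t) with hv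
  have eu : (s : ℝ) + t * β = q * u := by
    rw [hu, latticeVal]; field_simp
  have ev : (s : ℝ) + t * β' = q * v := by
    rw [hv, latticeVal]; field_simp
  have hd : 0 < β - β' := by linarith
  rw [div_lt_iff₀ hd] at hK
  have ht1 : (t : ℝ) * (β - β') < K * (β - β') := by nlinarith
  have ht2 : -(K : ℝ) * (β - β') < t * (β - β') := by nlinarith
  have ht1' := lt_of_mul_lt_mul_right ht1 hd.le
  have ht2' := lt_of_mul_lt_mul_right ht2 hd.le
  have hs1 : (s : ℝ) < L := by nlinarith
  have hs2 : -(L : ℝ) < s := by nlinarith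
  simp only [Set.mem_prod, Set.mem_Icc]
  refine ⟨⟨?_, ?_⟩, ?_, ?_⟩
  · exact le_of_lt (by exact_mod_cast hs2)
  · exact le_of_lt (by exact_mod_cast hs1)
  · exact le_of_lt (by exact_mod_cast ht2')
  · exact le_of_lt (by exact_mod_cast ht1')

/-- An injective self-map of a finite set has only periodic points. -/
theorem exists_iterate_eq_of_mapsTo_of_injOn {α : Type*} {f : α → α} {S : Set α} (hS : S.Finite)
    (hm : Set.MapsTo f S S) (hi : Set.InjOn f S) {a : α} (ha : a ∈ S) :
    ∃ N, 0 < N ∧ f^[N] a = a := by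
  have : Finite S := hS
  obtain ⟨N, hN, h⟩ :=
    Function.mem_periodicPts.1 ((hm.restrict_inj.2 hi).mem_periodicPts (⟨a, ha⟩ : S))
  refine ⟨N, hN, ?_⟩
  have h' := congrArg Subtype.val h.eq
  rwa [hm.iterate_restrict N, Set.MapsTo.val_restrict_apply] at h'

theorem theorem4 (β β' : ℝ) (hPisot : IsPisot β) (hUnit : IsAlgebraicUnit β)
    (hQuad : IsQuadratic β) (hConj : IsOtherConjugate β β') (hPos : 0 < β')
    (x : ℚ) (hx : (x : ℝ) ∈ negInterval β) :
    HasPurelyPeriodicNegExpansion β (x : ℝ) := by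
  obtain ⟨hlt, hprod, m, hsum⟩ :=
    exists_trace_of_quadratic_pisot_unit hPisot hUnit hQuad hConj hPos
  have h1 : 1 < β := hPisot.1
  have h2 : 2 < β := by
    -- `β + β⁻¹ > 2` because `(β - 1)² > 0`, so the integer `m` is at least `3`.
    have : (2 : ℝ) < m := by nlinarith
    have : 2 < m := by exact_mod_cast this
    have : (3 : ℝ) ≤ m := by exact_mod_cast this
    linarith
  have hβ : β ^ 2 = m * β - 1 := by rw [← hsum]; linear_combination -hprod
  have hβ' : β' ^ 2 = m * β' - 1 := by rw [← hsum]; linear_combination -hprod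
  set q : ℤ := (x.den : ℤ) with hqdef
  have hq : 0 < q := Int.natCast_pos.2 x.den_pos
  have hval : ∀ α, latticeVal q α (x.num, 0) = x := by
    intro α
    have := Rat.cast_def (K := ℝ) x
    simp [latticeVal, hqdef, this]
  have hstep : Function.Semiconj (latticeVal q β) (latticeStep q m β) (negTransform β) :=
    fun p => latticeVal_latticeStep β hq.ne' hβ p
  obtain ⟨N, hN, hper⟩ := exists_iterate_eq_of_mapsTo_of_injOn
    (f := latticeStep q m β) (a := (x.num, 0))
    (finite_setOf_negDomain hq hPos h1 hlt)
    (fun p hp => by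
      have h := NegDomain.step h1 hPos hlt hprod hsum hp
      rwa [← latticeVal_latticeStep β hq.ne' hβ' p, ← hstep.eq p] at h)
    (fun p hp p₁ hp₁ heq => by
      have hv := congrArg (latticeVal q β') heq
      rw [latticeVal_latticeStep β hq.ne' hβ', latticeVal_latticeStep β hq.ne' hβ'] at hv
      have hd := le_antisymm (NegDomain.digit_le hPos hprod hp hp₁ hv)
        (NegDomain.digit_le hPos hprod hp₁ hp hv.symm)
      simp only [latticeStep, Prod.mk.injEq, hd, sub_left_inj] at heq
      obtain ⟨e2, e1⟩ := heq
      rw [e2] at e1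
      exact Prod.ext (by linarith) e2)
    (by
      rw [Set.mem_ofPred_eq, hval, hval]
      exact NegDomain.diagonal h2 hPos hprod hx)
  have hperx : (negTransform β)^[N] x = x := by
    have h := hstep.iterate_right N (x.num, 0)
    rw [hper, hval] at h
    exact h.symm
  refine ⟨N, hN, fun i => ?_⟩
  simp only [negExpansion, Function.iterate_add_apply, hperx]
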